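/- **Setting.** Let $f:\mathbb R^n\to\mathbb R$ be twice continuously differentiable with $\lambda_1 I\preceq\nabla^2 f(x)\preceq\lambda_n I$ for all $x$, where $0<\lambda_1\le\lambda_n$; let $x^*$ be its minimizer and $f^*=f(x^*)$. Fix $c,\bar\eta,\tau\in(0,1)$, $0<\theta<c/2$, $0<t_0\le t_{\max}$ and $x_0\in\mathbb R^n$. The linesearch Newton-CG method with controllable noise starts from $(x_0,t_0)$ and performs for $k=0,1,2,\dots$ the following iteration, in which $g_k$ and $H_k$ are random estimates of $\nabla f(x_k)$ and $\nabla^2f(x_k)$. 1. Choose $\eta_k\in(0,\bar\eta)$. 2. Apply the conjugate gradient method with null initial guess to $H_ks=-g_k$ and let $s_k$ be an iterate of it with $H_ks_k=-g_k+r_k$, $\|r_k\|\le\eta_k\|g_k\|$. 3. Compute noisy values $\tilde f(x_k)$, $\tilde f(x_k+t_ks_k)$ whose errors $|f-\tilde f|$ at the two points are at most $-\theta t_ks_k^Tg_k$. 4. If $\tilde f(x_k+t_ks_k)\le\tilde f(x_k)+c\,t_ks_k^Tg_k$, set $x_{k+1}=x_k+t_ks_k$ and $t_{k+1}=\min\{t_{\max},\tau^{-1}t_k\}$;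 otherwise set $x_{k+1}=x_k$ and $t_{k+1}=\tau t_k$. Assume that $\lambda_1I\preceq H_k\preceq\lambda_nI$ for all $k$ and all realizations, and that the gradient estimates are $(1-\delta_g)$-probabilistically sufficiently accurate: for all $k\ge0$, almost surely $$P\big(\|g_k-\nabla f(x_k)\|\le t_k\eta_k\|g_k\| \;\big|\; \mathcal F_{k-1}\big)\ge 1-\delta_g ,$$ where $(\mathcal F_{k-1})_{k\ge 0}$ is a filtration such that $\mathcal F_{k-1}$ contains the history of the algorithm (gradient and Hessian estimates, forcing terms, steps, noisy function values) of the iterations $0,\dots,k-1$. Call $\kappa_1,\kappa_2,\beta>0$ *step constants* if, for all $k$ and all realizations, $$\kappa_1\|g_k\|\le\|s_k\|\le\kappa_2\|g_k\|,\qquad -g_k^Ts_k\ge\beta\|s_k\|^2,$$ and $\frac{1-\bar\eta}{\lambda_n}\le\kappa_1\le\kappa_2\le\frac1{\lambda_1}$, $\beta\ge\lambda_1$. For $0<\epsilon\le f(x_0)-f^*$ let $N_\epsilon$ be the smallest $k$ with $f(x_k)-f^*\le\epsilon$ ($\infty$ if there is none). **Theorem.** Let $0<\delta_g<\frac12$.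 Then $\kappa_1=\frac{1-\bar\eta}{\lambda_n}$, $\kappa_2=\frac1{\lambda_1}$, $\beta=\lambda_1$ are step constants. Moreover, let $\kappa_1,\kappa_2,\beta$ be any step constants, put $$\hat t=\frac{2\kappa_1\beta}{\kappa_1\lambda_n+2}(1-c-2\theta),$$ and let $0<\bar t\le\min\{\hat t,\tau t_0\}$ be such that either * $\bar t=\tau^jt_0$ and $t_0=\tau^it_{\max}$ for some integers $i,j\ge0$ (for instance $\bar t=\hat t$, if $\hat t$ itself has this form), or * $\bar t\le\tau\hat t$ (with no condition on $t_0$, $t_{\max}$ and $\tau$ besides the above). Then $M=\dfrac{2(c-2\theta)\beta\kappa_1^2\lambda_1\bar t}{(1+t_{\max})^2}$ lies in $(0,1)$ and $$\mathbb E[N_\epsilon]\le\frac{2(1-\delta_g)}{(1-2\delta_g)^2}\left[2\log_{1/(1-M)}\left(\frac{f(x_0)-f^*}{\epsilon}\right)+\log_\tau\frac{\bar t}{t_0}\right].$$ -/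

import Mathlib

open MeasureTheory ProbabilityTheory
open scoped ENNReal

namespace NewtonCG

noncomputable section

/-- The Euclidean space `ℝⁿ`. -/
abbrev E (n : ℕ) : Type := EuclideanSpace ℝ (Fin n)

/-- The matrix-vector product on `ℝⁿ`. -/
def mulVecE {n : ℕ} (A : Matrix (Fin n) (Fin n) ℝ) (v : E n) : E n :=
  WithLp.toLp 2 (A.mulVec v.ofLp)

/-- `a I ⪯ A ⪯ b I` in the Loewner order (in particular `A` is symmetric). -/
def SpectralBounds {n : ℕ} (a b : ℝ) (A : Matrix (Fin n) (Fin n) ℝ) : Prop :=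
  (A - a • (1 : Matrix (Fin n) (Fin n) ℝ)).PosSemidef ∧
    (b • (1 : Matrix (Fin n) (Fin n) ℝ) - A).PosSemidef

/-- The Hessian matrix of `f` at `x`. -/
def hessian {n : ℕ} (f : E n → ℝ) (x : E n) : Matrix (Fin n) (Fin n) ℝ :=
  Matrix.of fun i j =>
    fderiv ℝ (fderiv ℝ f) x (EuclideanSpace.single i 1) (EuclideanSpace.single j 1)

/-- `f` is twice continuously differentiable with `a I ⪯ ∇²f(x) ⪯ b I` for all `x`. -/
def SmoothStronglyConvex {n : ℕ} (a b : ℝ) (f : E n → ℝ) : Prop :=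
  ContDiff ℝ 2 f ∧ ∀ x, SpectralBounds a b (hessian f x)

/-! ### The conjugate gradient method -/

/-- The state of the conjugate gradient method: iterate, residual, search direction. -/
structure CGState (n : ℕ) where
  x : E n
  r : E n
  p : E n

/-- One iteration of the (Hestenes–Stiefel) conjugate gradient method for `A x = b`. Once the
residual vanishes the quotients below are `0 / 0 = 0` and the iterate does not change any more. -/
def cgStep {n : ℕ} (A : Matrix (Fin n) (Fin n) ℝ) (σ : CGState n) : CGState n :=
  let α : ℝ := inner ℝ σ.r σ.r / inner ℝ σ.p (mulVecE A σ.p)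
  let r' : E n := σ.r - α • mulVecE A σ.p
  { x := σ.x + α • σ.p
    r := r'
    p := r' + (inner ℝ r' r' / inner ℝ σ.r σ.r : ℝ) • σ.p }

/-- The state after `j` iterations of the conjugate gradient method for `A x = b`
with null initial guess. -/
def cgState {n : ℕ} (A : Matrix (Fin n) (Fin n) ℝ) (b : E n) : ℕ → CGState n
  | 0 => { x := 0, r := b, p := b }
  | j + 1 => cgStep A (cgState A b j)

/-- The `j`-th conjugate gradient iterate for `A x = b` with null initial guess. -/
def cgIterate {n : ℕ} (A : Matrix (Fin n) (Fin n) ℝ) (b : E n) (j : ℕ) : E n :=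
  (cgState A b j).x

/-- `s` is an inexact Newton step with forcing term `η`, that is `H s = -g + r` with
`‖r‖ ≤ η ‖g‖`, produced by the conjugate gradient method for `H s = -g` with null
initial guess. -/
def IsNewtonCGStep {n : ℕ} (H : Matrix (Fin n) (Fin n) ℝ) (g : E n) (η : ℝ) (s : E n) : Prop :=
  (∃ j : ℕ, s = cgIterate H (-g) j) ∧ ∃ r : E n, mulVecE H s = -g + r ∧ ‖r‖ ≤ η * ‖g‖

/-! ### The stochastic process generated by the algorithm -/

/-- The parameters of the algorithm. -/
structure Params where
  /-- the Armijo constant -/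
  c : ℝ
  /-- the noise control constant -/
  θ : ℝ
  /-- the upper bound for the forcing terms -/
  ηbar : ℝ
  /-- the step length update factor -/
  τ : ℝ
  /-- the maximal step length -/
  tmax : ℝ
  /-- the initial step length -/
  t0 : ℝ

/-- The admissible values of the parameters. -/
structure Params.Valid (P : Params) : Prop where
  c_pos : 0 < P.c
  c_lt_one : P.c < 1
  θ_pos : 0 < P.θ
  θ_lt : P.θ < P.c / 2
  ηbar_pos : 0 < P.ηbar
  ηbar_lt_one : P.ηbar < 1
  τ_pos : 0 < P.τ
  τ_lt_one : P.τ < 1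
  t0_pos : 0 < P.t0
  t0_le_tmax : P.t0 ≤ P.tmax

/-- The random quantities that occur in the course of the algorithm. -/
structure RandomRun (n : ℕ) (Ω : Type*) where
  /-- the iterates -/
  X : ℕ → Ω → E n
  /-- the step lengths -/
  T : ℕ → Ω → ℝ
  /-- the gradient estimators -/
  G : ℕ → Ω → E n
  /-- the Hessian estimators -/
  H : ℕ → Ω → Matrix (Fin n) (Fin n) ℝ
  /-- the forcing terms -/
  η : ℕ → Ω → ℝ
  /-- the search directions -/
  S : ℕ → Ω → E n
  /-- the noisy value of `f` at the iterate `x_k`, computed in iteration `k` -/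
  fcur : ℕ → Ω → ℝ
  /-- the noisy value of `f` at the trial point `x_k + t_k s_k`, computed in iteration `k` -/
  ftrial : ℕ → Ω → ℝ

namespace RandomRun

variable {n : ℕ} {Ω : Type*}

/-- Iteration `k` is successful: the Armijo condition holds for the noisy values. -/
def Successful (A : RandomRun n Ω) (P : Params) (k : ℕ) (ω : Ω) : Prop :=
  A.ftrial k ω ≤ A.fcur k ω + P.c * A.T k ω * inner ℝ (A.S k ω) (A.G k ω)

/-- The event that iteration `k` is true: the gradient estimate is accurate. -/
def trueEvent (A : RandomRun n Ω) (f : E n → ℝ) (k : ℕ) : Set Ω :=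
  {ω | ‖A.G k ω - gradient f (A.X k ω)‖ ≤ A.T k ω * A.η k ω * ‖A.G k ω‖}

/-- Every realization of the process is a run of the linesearch Newton-CG algorithm with
controllable noise, applied to `f` and started at `x0` with step length `t0`. -/
structure IsRun (A : RandomRun n Ω) (f : E n → ℝ) (P : Params) (x0 : E n) : Prop where
  X_zero : ∀ ω, A.X 0 ω = x0
  T_zero : ∀ ω, A.T 0 ω = P.t0
  η_mem : ∀ k ω, A.η k ω ∈ Set.Ioo 0 P.ηbar
  step : ∀ k ω, IsNewtonCGStep (A.H k ω) (A.G k ω) (A.η k ω) (A.S k ω)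
  noise_cur : ∀ k ω, |f (A.X k ω) - A.fcur k ω| ≤
    -P.θ * A.T k ω * inner ℝ (A.S k ω) (A.G k ω)
  noise_trial : ∀ k ω, |f (A.X k ω + A.T k ω • A.S k ω) - A.ftrial k ω| ≤
    -P.θ * A.T k ω * inner ℝ (A.S k ω) (A.G k ω)
  update_success : ∀ k ω, A.Successful P k ω →
    A.X (k + 1) ω = A.X k ω + A.T k ω • A.S k ω ∧
      A.T (k + 1) ω = min P.tmax (P.τ⁻¹ * A.T k ω)
  update_failure : ∀ k ω, ¬ A.Successful P k ω →
    A.X (k + 1) ω = A.X k ω ∧ A.T (k + 1) ω = P.τ * A.T k ω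

/-- `ℱ k` contains the history of the algorithm up to the beginning of iteration `k`, that is
everything that is estimated, chosen or evaluated in the iterations `0, …, k - 1`. -/
structure Adapted {mΩ : MeasurableSpace Ω} (A : RandomRun n Ω) (ℱ : Filtration ℕ mΩ) : Prop where
  G_meas : ∀ k, Measurable[ℱ (k + 1)] (A.G k)
  H_meas : ∀ k i j, Measurable[ℱ (k + 1)] fun ω => A.H k ω i j
  η_meas : ∀ k, Measurable[ℱ (k + 1)] (A.η k)
  S_meas : ∀ k, Measurable[ℱ (k + 1)] (A.S k)
  fcur_meas : ∀ k, Measurable[ℱ (k + 1)] (A.fcur k)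
  ftrial_meas : ∀ k, Measurable[ℱ (k + 1)] (A.ftrial k)

/-- The gradient estimators are `(1 - δ)`-probabilistically sufficiently accurate: the conditional
probability, given the history, that iteration `k` is true is at least `1 - δ`. -/
def GradientAccurate {mΩ : MeasurableSpace Ω} (A : RandomRun n Ω) (μ : Measure Ω)
    (ℱ : Filtration ℕ mΩ) (f : E n → ℝ) (δ : ℝ) : Prop :=
  ∀ k, ∀ᵐ ω ∂μ, 1 - δ ≤ (μ⟦A.trueEvent f k | ℱ k⟧) ω

/-- `N_ε`: the first `k` with `f(x_k) - f* ≤ ε` (`⊤` if there is none). -/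
def hittingTime (A : RandomRun n Ω) (f : E n → ℝ) (fstar ε : ℝ) (ω : Ω) : ℕ∞ :=
  ⨅ (k : ℕ) (_ : f (A.X k ω) - fstar ≤ ε), (k : ℕ∞)

/-- `κ₁, κ₂, β` are constants for the Newton-CG steps of the process:
`κ₁ ‖g_k‖ ≤ ‖s_k‖ ≤ κ₂ ‖g_k‖` and `-g_kᵀ s_k ≥ β ‖s_k‖²` in all iterations of all realizations,
with `(1 - ηbar) / lamn ≤ κ₁ ≤ κ₂ ≤ 1 / lam1` and `β ≥ lam1`. -/
structure StepConstants (A : RandomRun n Ω) (P : Params) (lam1 lamn κ₁ κ₂ β : ℝ) : Prop where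
  κ₁_pos : 0 < κ₁
  κ₂_pos : 0 < κ₂
  β_pos : 0 < β
  lower : ∀ k ω, κ₁ * ‖A.G k ω‖ ≤ ‖A.S k ω‖
  upper : ∀ k ω, ‖A.S k ω‖ ≤ κ₂ * ‖A.G k ω‖
  descent : ∀ k ω, β * ‖A.S k ω‖ ^ 2 ≤ -inner ℝ (A.G k ω) (A.S k ω)
  le_κ₁ : (1 - P.ηbar) / lamn ≤ κ₁
  κ₁_le_κ₂ : κ₁ ≤ κ₂
  κ₂_le : κ₂ ≤ 1 / lam1
  le_β : lam1 ≤ β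

end RandomRun

/-- The threshold `2 κ₁ β (1 - c - 2θ) / (κ₁ lamn + 2)` for the step length. -/
def Params.threshold (P : Params) (lamn κ₁ β : ℝ) : ℝ :=
  2 * κ₁ * β / (κ₁ * lamn + 2) * (1 - P.c - 2 * P.θ)

/-- `M = 2 (c - 2θ) β κ₁² lam1 t / (1 + tmax)²`. -/
def Params.M (P : Params) (lam1 κ₁ β t : ℝ) : ℝ :=
  2 * (P.c - 2 * P.θ) * β * κ₁ ^ 2 * lam1 * t / (1 + P.tmax) ^ 2

end

end NewtonCG

/-! The argument is a pathwise potential estimate followed by a self-bounding estimate for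
expectations. Let the level of a step length be the integer part of $\log_{1/\tau}(t_k/\bar t)$.
Conjugate gradient iterates are orthogonal to their residuals, so the steps are descent directions
with explicit constants. Noise costs at most $2\theta$ of the Armijo constant $c$, hence $f$ never
increases along the iterates, accurate gradient or not. A true iteration of level at most 0 succeeds
(`IsRun.successful_of_le_threshold`); a true success of level at least 0 shrinks the gap by $1-M$
(`IsRun.gap_contraction`). Each iteration therefore either moves the level one towards 0, or is one
of these contractions, or is false. In the last two cases $K+|\text{level}|$ grows by at most 2, in
the first not at all. So `IsRun.exists_contractions` bounds $K$ by the initial level plus twice the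
number of contractions plus twice the number of false iterations. While the gap exceeds $\epsilon$,
there are at most $F=\log_{1/(1-M)}((f(x_0)-f^*)/\epsilon)$ contractions. Let $B_k$ be the event
that the gap at $k$ exceeds $\epsilon$. It is decreasing in $k$ and belongs to the history, so the
probability of $B_k$ with iteration $k$ false is at most $\delta_g P(B_k)$. With
$C=2F+\log_\tau(\bar t/t_0)$, the partial sums $S$ of $P(B_k)$ satisfy $S\le 1+C+2\delta_gS$. As
$\mathbb E[N_\epsilon]\le\sum_k P(B_k)$, this gives $(1+C)/(1-2\delta_g)$, which is sharper than the
claim. -/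

namespace NewtonCG

/-! ### Matrix-vector products and spectral bounds -/

section MulVec

variable {n : ℕ} {A : Matrix (Fin n) (Fin n) ℝ} {a b : ℝ}

lemma mulVecE_add (x y : E n) : mulVecE A (x + y) = mulVecE A x + mulVecE A y := by
  simp [mulVecE, Matrix.mulVec_add]

lemma mulVecE_sub (x y : E n) : mulVecE A (x - y) = mulVecE A x - mulVecE A y := by
  simp [mulVecE, Matrix.mulVec_sub]

lemma mulVecE_smul (t : ℝ) (x : E n) : mulVecE A (t • x) = t • mulVecE A x := by
  simp [mulVecE, Matrix.mulVec_smul]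

lemma mulVecE_zero : mulVecE A (0 : E n) = 0 := by
  simp [mulVecE]

lemma inner_mulVecE (x y : E n) : inner ℝ x (mulVecE A y) = x.ofLp ⬝ᵥ A.mulVec y.ofLp := by
  simp [mulVecE, EuclideanSpace.inner_eq_star_dotProduct, dotProduct_comm]

lemma inner_mulVecE_comm (hA : A.IsHermitian) (x y : E n) :
    inner ℝ x (mulVecE A y) = inner ℝ y (mulVecE A x) := by
  have hT : A.transpose = A := by simpa [Matrix.IsHermitian] using hA
  rw [inner_mulVecE, inner_mulVecE, Matrix.dotProduct_mulVec, ← Matrix.mulVec_transpose, hT,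
    dotProduct_comm]

lemma SpectralBounds.isHermitian (h : SpectralBounds a b A) : A.IsHermitian := by
  have h1 : (a • (1 : Matrix (Fin n) (Fin n) ℝ)).IsHermitian := by
    simp [Matrix.IsHermitian]
  simpa using h.1.isHermitian.add h1

lemma SpectralBounds.le_inner (h : SpectralBounds a b A) (x : E n) :
    a * ‖x‖ ^ 2 ≤ inner ℝ x (mulVecE A x) := by
  have h1 := h.1.dotProduct_mulVec_nonneg x.ofLp
  rw [inner_mulVecE, ← real_inner_self_eq_norm_sq, EuclideanSpace.inner_eq_star_dotProduct]
  simp only [star_trivial, Matrix.sub_mulVec, Matrix.smul_mulVec, Matrix.one_mulVec,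
    dotProduct_sub, dotProduct_smul, smul_eq_mul] at h1 ⊢
  linarith

lemma SpectralBounds.inner_le (h : SpectralBounds a b A) (x : E n) :
    inner ℝ x (mulVecE A x) ≤ b * ‖x‖ ^ 2 := by
  have h1 := h.2.dotProduct_mulVec_nonneg x.ofLp
  rw [inner_mulVecE, ← real_inner_self_eq_norm_sq, EuclideanSpace.inner_eq_star_dotProduct]
  simp only [star_trivial, Matrix.sub_mulVec, Matrix.smul_mulVec, Matrix.one_mulVec,
    dotProduct_sub, dotProduct_smul, smul_eq_mul] at h1 ⊢
  linarith

lemma SpectralBounds.norm_mulVecE_le (h : SpectralBounds a b A) (ha : 0 ≤ a) (hb : 0 < b)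
    (x : E n) : ‖mulVecE A x‖ ≤ b * ‖x‖ := by
  set v := mulVecE A x with hv
  -- Testing positivity on $bx-Ax$ replaces diagonalization: with $\langle v,Av\rangle\le b\|v\|^2$
  -- it yields $\|v\|^2\le b\langle x,v\rangle$.
  have h0 : 0 ≤ inner ℝ (b • x - v) (mulVecE A (b • x - v)) :=
    (by positivity : (0 : ℝ) ≤ a * ‖b • x - v‖ ^ 2).trans (h.le_inner _)
  have h1 := h.inner_le v
  have h2 := h.inner_le x
  have h3 := inner_mulVecE_comm h.isHermitian x v
  rw [mulVecE_sub, mulVecE_smul, ← hv] at h0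
  simp only [inner_sub_left, inner_sub_right, real_inner_smul_left, real_inner_smul_right] at h0
  rw [← hv] at h2 h3
  have hvv : inner ℝ v v = ‖v‖ ^ 2 := real_inner_self_eq_norm_sq v
  rw [h3, hvv] at h0
  have h4 : b * ‖v‖ ^ 2 ≤ b * (b * ‖x‖) ^ 2 := by
    have := mul_le_mul_of_nonneg_left h2 (mul_nonneg hb.le hb.le)
    nlinarith
  exact le_of_sq_le_sq (le_of_mul_le_mul_left h4 hb) (by positivity)

end MulVec

/-! ### Orthogonality relations of the conjugate gradient method -/

section CG

variable {n : ℕ} {A : Matrix (Fin n) (Fin n) ℝ} {a b : ℝ} (v : E n)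

lemma cgState_succ_x (j : ℕ) : (cgState A v (j + 1)).x = (cgState A v j).x +
    (inner ℝ (cgState A v j).r (cgState A v j).r /
      inner ℝ (cgState A v j).p (mulVecE A (cgState A v j).p)) • (cgState A v j).p := rfl

lemma cgState_succ_r (j : ℕ) : (cgState A v (j + 1)).r = (cgState A v j).r -
    (inner ℝ (cgState A v j).r (cgState A v j).r /
      inner ℝ (cgState A v j).p (mulVecE A (cgState A v j).p)) • mulVecE A (cgState A v j).p := rfl

lemma cgState_succ_p (j : ℕ) : (cgState A v (j + 1)).p = (cgState A v (j + 1)).r +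
    (inner ℝ (cgState A v (j + 1)).r (cgState A v (j + 1)).r /
      inner ℝ (cgState A v j).r (cgState A v j).r) • (cgState A v j).p := rfl

/-- The residual carried along by the conjugate gradient method is the true residual. -/
lemma cgState_residual (j : ℕ) : (cgState A v j).r = v - mulVecE A (cgState A v j).x := by
  induction j with
  | zero => simp [cgState, mulVecE_zero]
  | succ j ih => rw [cgState_succ_r, cgState_succ_x, mulVecE_add, mulVecE_smul, ih]; abel

/-- The search direction vanishes together with the residual. -/
lemma cgState_p_eq_zero (j : ℕ) (h : (cgState A v j).r = 0) : (cgState A v j).p = 0 := by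
  cases j with
  | zero => exact h
  | succ j => rw [cgState_succ_p, h]; simp

lemma inner_mulVecE_self_ne_zero (hA : SpectralBounds a b A) (ha : 0 < a) {x : E n} (hx : x ≠ 0) :
    inner ℝ x (mulVecE A x) ≠ 0 := by
  have h1 := hA.le_inner x
  have h2 : 0 < ‖x‖ := norm_pos_iff.2 hx
  have h3 : 0 < a * ‖x‖ ^ 2 := by positivity
  linarith

/-- The exact line search equation, given that `p_jᵀ r_j = r_jᵀ r_j`. -/
lemma cgState_steplength (hA : SpectralBounds a b A) (ha : 0 < a) (j : ℕ)
    (h : inner ℝ (cgState A v j).p (cgState A v j).r =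
      inner ℝ (cgState A v j).r (cgState A v j).r) :
    inner ℝ (cgState A v j).r (cgState A v j).r /
      inner ℝ (cgState A v j).p (mulVecE A (cgState A v j).p) *
      inner ℝ (cgState A v j).p (mulVecE A (cgState A v j).p) =
    inner ℝ (cgState A v j).r (cgState A v j).r := by
  by_cases hp : (cgState A v j).p = 0
  · rw [← h, hp]; simp
  · exact div_mul_cancel₀ _ (inner_mulVecE_self_ne_zero hA ha hp)

lemma inner_cgState_p_succ_r (hA : SpectralBounds a b A) (ha : 0 < a) (j : ℕ)
    (h : inner ℝ (cgState A v j).p (cgState A v j).r =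
      inner ℝ (cgState A v j).r (cgState A v j).r) :
    inner ℝ (cgState A v j).p (cgState A v (j + 1)).r = 0 := by
  rw [cgState_succ_r, inner_sub_right, real_inner_smul_right, cgState_steplength v hA ha j h, h,
    sub_self]

/-- The residuals are mutually orthogonal and the search directions are mutually conjugate. -/
lemma cgState_orthogonal (hA : SpectralBounds a b A) (ha : 0 < a) (j : ℕ) :
    inner ℝ (cgState A v j).p (cgState A v j).r = inner ℝ (cgState A v j).r (cgState A v j).r ∧
    ∀ i < j, inner ℝ (cgState A v i).r (cgState A v j).r = 0 ∧
      inner ℝ (cgState A v i).p (mulVecE A (cgState A v j).p) = 0 := by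
  induction j with
  | zero => exact ⟨rfl, fun i hi => absurd hi (Nat.not_lt_zero i)⟩
  | succ j ih =>
    obtain ⟨hpr, horth⟩ := ih
    have hstep := cgState_steplength v hA ha j hpr
    have hrA : ∀ i ≤ j, inner ℝ (cgState A v i).r (mulVecE A (cgState A v j).p) =
        inner ℝ (cgState A v i).p (mulVecE A (cgState A v j).p) := by
      intro i hi
      cases i with
      | zero => rfl
      | succ i =>
        rw [cgState_succ_p, inner_add_left, real_inner_smul_left, (horth i hi).2, mul_zero,
          add_zero]
    have hr : ∀ i ≤ j, inner ℝ (cgState A v i).r (cgState A v (j + 1)).r = 0 := by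
      intro i hi
      rw [cgState_succ_r, inner_sub_right, real_inner_smul_right, hrA i hi]
      rcases hi.lt_or_eq with hlt | rfl
      · rw [(horth i hlt).1, (horth i hlt).2, mul_zero, sub_zero]
      · rw [hstep, sub_self]
    refine ⟨?_, fun i hi => ⟨hr i (Nat.lt_succ_iff.1 hi), ?_⟩⟩
    · nth_rewrite 1 [cgState_succ_p]
      rw [inner_add_left, real_inner_smul_left, inner_cgState_p_succ_r v hA ha j hpr, mul_zero,
        add_zero]
    · have hij := Nat.lt_succ_iff.1 hi
      by_cases hp : (cgState A v i).p = 0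
      · rw [hp, inner_zero_left]
      have hpAp := inner_mulVecE_self_ne_zero hA ha hp
      have hri : inner ℝ (cgState A v i).r (cgState A v i).r ≠ 0 :=
        fun h => hp (cgState_p_eq_zero v i (inner_self_eq_zero.1 h))
      -- The residual recursion expresses $A p_i$ through $r_i-r_{i+1}$, so conjugacy of the new
      -- direction follows from orthogonality of residuals. For $i=j$ the direction update
      -- coefficient is exactly what cancels.
      have key := congrArg (fun z => inner ℝ (cgState A v (j + 1)).r z)
        (cgState_succ_r (A := A) v i)
      simp only [inner_sub_right, real_inner_smul_right] at key
      rw [real_inner_comm (cgState A v i).r, hr i hij, zero_sub] at key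
      rw [cgState_succ_p, mulVecE_add, mulVecE_smul, inner_add_right, real_inner_smul_right,
        inner_mulVecE_comm hA.isHermitian]
      rcases hij.lt_or_eq with hlt | rfl
      · rw [real_inner_comm, hr (i + 1) hlt] at key
        rw [(horth i hlt).2, mul_zero, add_zero]
        have := neg_eq_zero.1 key.symm
        exact (mul_eq_zero.1 this).resolve_left (div_ne_zero hri hpAp)
      · rw [key]
        field_simp
        ring

/-- The iterate is a combination of $p_0,\dots,p_{j-1}$, all conjugate to $p_m$. -/
lemma inner_cgState_x_mulVecE_p (hA : SpectralBounds a b A) (ha : 0 < a) {j m : ℕ} (hjm : j ≤ m) :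
    inner ℝ (cgState A v j).x (mulVecE A (cgState A v m).p) = 0 := by
  induction j with
  | zero => simp [cgState]
  | succ j ih =>
    rw [cgState_succ_x, inner_add_left, real_inner_smul_left, ih (by lia),
      ((cgState_orthogonal v hA ha m).2 j hjm).2, mul_zero, add_zero]

/-- Every conjugate gradient iterate is orthogonal to its residual. -/
lemma inner_cgState_x_r (hA : SpectralBounds a b A) (ha : 0 < a) (j : ℕ) :
    inner ℝ (cgState A v j).x (cgState A v j).r = 0 := by
  induction j with
  | zero => simp [cgState]
  | succ j ih =>
    rw [cgState_succ_x, inner_add_left, real_inner_smul_left,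
      inner_cgState_p_succ_r v hA ha j (cgState_orthogonal v hA ha j).1, cgState_succ_r,
      inner_sub_right, real_inner_smul_right, ih, inner_cgState_x_mulVecE_p v hA ha le_rfl]
    ring

end CG

/-! ### Bounds for the Newton-CG steps -/

section Step

variable {n : ℕ} {H : Matrix (Fin n) (Fin n) ℝ} {g s : E n} {η a b : ℝ}

/-- The residual $-g-Hs$ is orthogonal to $s$. This is where the step being a conjugate gradient
iterate matters: the residual norm bound alone does not give it. -/
lemma IsNewtonCGStep.neg_inner_eq (h : IsNewtonCGStep H g η s) (hH : SpectralBounds a b H)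
    (ha : 0 < a) : -inner ℝ g s = inner ℝ s (mulVecE H s) := by
  obtain ⟨⟨j, rfl⟩, -⟩ := h
  have h1 := inner_cgState_x_r (-g) hH ha j
  rw [cgState_residual, inner_sub_right, inner_neg_right] at h1
  rw [cgIterate, real_inner_comm]
  linarith

lemma IsNewtonCGStep.descent (h : IsNewtonCGStep H g η s) (hH : SpectralBounds a b H)
    (ha : 0 < a) : a * ‖s‖ ^ 2 ≤ -inner ℝ g s :=
  (hH.le_inner s).trans (h.neg_inner_eq hH ha).ge

lemma IsNewtonCGStep.norm_le (h : IsNewtonCGStep H g η s) (hH : SpectralBounds a b H)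
    (ha : 0 < a) : ‖s‖ ≤ 1 / a * ‖g‖ := by
  have h1 := h.descent hH ha
  have h2 := neg_le_of_abs_le (abs_real_inner_le_norm g s)
  rw [one_div, inv_mul_eq_div, le_div_iff₀ ha]
  rcases (norm_nonneg s).eq_or_lt with h0 | h0
  · rw [← h0]; simp
  · have h3 : ‖s‖ * (‖s‖ * a) ≤ ‖s‖ * ‖g‖ := by nlinarith
    exact le_of_mul_le_mul_left h3 h0

lemma IsNewtonCGStep.le_norm (h : IsNewtonCGStep H g η s) (hH : SpectralBounds a b H)
    (ha : 0 ≤ a) (hb : 0 < b) : (1 - η) / b * ‖g‖ ≤ ‖s‖ := by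
  obtain ⟨-, r, hr, hrn⟩ := h
  have h1 := hH.norm_mulVecE_le ha hb s
  have h2 : g = r - mulVecE H s := by rw [hr]; abel
  have h3 := norm_sub_le r (mulVecE H s)
  rw [← h2] at h3
  rw [div_mul_eq_mul_div, div_le_iff₀ hb]
  linarith

end Step

lemma RandomRun.stepConstants_of_spectralBounds {n : ℕ} {Ω : Type*} {f : E n → ℝ} {x0 : E n}
    {lam1 lamn : ℝ} {P : Params} {A : RandomRun n Ω} (hP : P.Valid) (hlam1 : 0 < lam1)
    (hlamn : lam1 ≤ lamn) (hrun : A.IsRun f P x0)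
    (hH : ∀ k ω, SpectralBounds lam1 lamn (A.H k ω)) :
    A.StepConstants P lam1 lamn ((1 - P.ηbar) / lamn) (1 / lam1) lam1 where
  κ₁_pos := div_pos (by linarith [hP.ηbar_lt_one]) (by linarith)
  κ₂_pos := by positivity
  β_pos := hlam1
  lower k ω := by
    have h0 : 0 < lamn := hlam1.trans_le hlamn
    refine le_trans ?_ ((hrun.step k ω).le_norm (hH k ω) hlam1.le h0)
    have := (hrun.η_mem k ω).2
    gcongr
  upper k ω := (hrun.step k ω).norm_le (hH k ω) hlam1
  descent k ω := (hrun.step k ω).descent (hH k ω) hlam1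
  le_κ₁ := le_rfl
  κ₁_le_κ₂ := by
    have h0 : 0 < lamn := hlam1.trans_le hlamn
    have h1 := hP.ηbar_pos
    have h2 := hP.ηbar_lt_one
    gcongr
    linarith
  κ₂_le := le_rfl
  le_β := le_rfl

/-! ### Quadratic bounds for smooth strongly convex functions -/

/-- Second order upper Taylor bound on `[0, 1]`. -/
lemma taylor_le_of_second_deriv_le {φ φ' φ'' : ℝ → ℝ} {b : ℝ} (h1 : ∀ t, HasDerivAt φ (φ' t) t)
    (h2 : ∀ t, HasDerivAt φ' (φ'' t) t) (hb : ∀ t, φ'' t ≤ b) :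
    φ 1 ≤ φ 0 + φ' 0 + b / 2 := by
  have hd : ∀ t, HasDerivAt (fun t => φ' t - b * t) (φ'' t - b) t := fun t => by
    have := (h2 t).fun_sub ((hasDerivAt_id t).const_mul b)
    rwa [mul_one] at this
  have hanti : Antitone fun t => φ' t - b * t :=
    antitone_of_deriv_nonpos (fun t => (hd t).differentiableAt)
      fun t => by rw [(hd t).deriv]; linarith [hb t]
  have he : ∀ t, HasDerivAt (fun t => φ t - φ' 0 * t - b / 2 * t ^ 2)
      (φ' t - φ' 0 - b * t) t := fun t => by
    have := ((h1 t).fun_sub ((hasDerivAt_id t).const_mul (φ' 0))).fun_sub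
      (((hasDerivAt_pow 2 t)).const_mul (b / 2))
    refine this.congr_deriv ?_
    push_cast
    ring
  have hanti2 : AntitoneOn (fun t => φ t - φ' 0 * t - b / 2 * t ^ 2) (Set.Icc 0 1) := by
    refine antitoneOn_of_deriv_nonpos (convex_Icc 0 1)
      (fun t _ => (he t).continuousAt.continuousWithinAt)
      (fun t _ => (he t).differentiableAt.differentiableWithinAt) fun t ht => ?_
    rw [interior_Icc] at ht
    rw [(he t).deriv]
    have := hanti ht.1.le
    simp only at this
    linarith
  have := hanti2 (Set.left_mem_Icc.2 zero_le_one) (Set.right_mem_Icc.2 zero_le_one) zero_le_one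
  simp only at this
  linarith

section Smooth

variable {n : ℕ} {f : E n → ℝ} {a b : ℝ}

lemma fderiv_fderiv_eq_inner_hessian (x d : E n) :
    fderiv ℝ (fderiv ℝ f) x d d = inner ℝ d (mulVecE (hessian f x) d) := by
  have hd : d = ∑ i, d i • (EuclideanSpace.single i 1 : E n) := by
    have := (EuclideanSpace.basisFun (Fin n) ℝ).sum_repr d
    simpa using this.symm
  rw [inner_mulVecE]
  conv_lhs => rw [hd]
  simp only [map_sum, map_smul, FunLike.coe_sum, Finset.sum_apply, FunLike.coe_smul, Pi.smul_apply,
    smul_eq_mul, dotProduct, Matrix.mulVec, hessian, Matrix.of_apply]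
  simp only [Finset.mul_sum]
  rw [Finset.sum_comm]
  exact Finset.sum_congr rfl fun i _ => Finset.sum_congr rfl fun j _ => by ring

lemma SmoothStronglyConvex.hasDerivAt_line (hf : SmoothStronglyConvex a b f) (x d : E n) (t : ℝ) :
    HasDerivAt (fun t : ℝ => f (x + t • d)) (fderiv ℝ f (x + t • d) d) t := by
  have hl : HasDerivAt (fun t : ℝ => x + t • d) d t := by
    simpa using ((hasDerivAt_id t).smul_const d).const_add x
  exact ((hf.1.differentiable two_ne_zero).differentiableAt.hasFDerivAt).comp_hasDerivAt t hl

lemma SmoothStronglyConvex.hasDerivAt_fderiv_line (hf : SmoothStronglyConvex a b f) (x d : E n)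
    (t : ℝ) : HasDerivAt (fun t : ℝ => fderiv ℝ f (x + t • d) d)
      (fderiv ℝ (fderiv ℝ f) (x + t • d) d d) t := by
  have hl : HasDerivAt (fun t : ℝ => x + t • d) d t := by
    simpa using ((hasDerivAt_id t).smul_const d).const_add x
  have h1 : ContDiff ℝ 1 (fderiv ℝ f) := hf.1.fderiv_right (by norm_num)
  have h2 := ((h1.differentiable one_ne_zero).differentiableAt.hasFDerivAt).comp_hasDerivAt t hl
  exact (ContinuousLinearMap.apply ℝ ℝ d).hasFDerivAt.comp_hasDerivAt t h2

lemma SmoothStronglyConvex.le_quadratic (hf : SmoothStronglyConvex a b f) (x d : E n) :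
    f (x + d) ≤ f x + inner ℝ (gradient f x) d + b / 2 * ‖d‖ ^ 2 := by
  have := taylor_le_of_second_deriv_le (hf.hasDerivAt_line x d) (hf.hasDerivAt_fderiv_line x d)
    fun t => (fderiv_fderiv_eq_inner_hessian (x + t • d) d).trans_le ((hf.2 _).inner_le d)
  simp only [one_smul, zero_smul, add_zero] at this
  rw [inner_gradient_left]
  linarith

/-- This is the upper Taylor bound applied to $-f$ on the segment. -/
lemma SmoothStronglyConvex.quadratic_le (hf : SmoothStronglyConvex a b f) (x d : E n) :
    f x + inner ℝ (gradient f x) d + a / 2 * ‖d‖ ^ 2 ≤ f (x + d) := by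
  have := taylor_le_of_second_deriv_le (b := -(a * ‖d‖ ^ 2))
    (fun t => (hf.hasDerivAt_line x d t).neg) (fun t => (hf.hasDerivAt_fderiv_line x d t).neg)
    fun t => neg_le_neg (((hf.2 _).le_inner d).trans_eq
      (fderiv_fderiv_eq_inner_hessian (x + t • d) d).symm)
  simp only [Pi.neg_apply, one_smul, zero_smul, add_zero] at this
  rw [inner_gradient_left]
  linarith

/-- The Polyak–Łojasiewicz inequality. -/
lemma SmoothStronglyConvex.gap_le_norm_gradient_sq (hf : SmoothStronglyConvex a b f) (ha : 0 < a)
    (x y : E n) : 2 * a * (f x - f y) ≤ ‖gradient f x‖ ^ 2 := by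
  have h1 := hf.quadratic_le x (y - x)
  rw [add_sub_cancel] at h1
  have h2 := neg_le_of_abs_le (abs_real_inner_le_norm (gradient f x) (y - x))
  nlinarith [sq_nonneg (‖gradient f x‖ - a * ‖y - x‖)]

lemma SmoothStronglyConvex.continuous_gradient (hf : SmoothStronglyConvex a b f) :
    Continuous (gradient f) :=
  (InnerProductSpace.toDual ℝ (E n)).symm.continuous.comp (hf.1.continuous_fderiv two_ne_zero)

end Smooth

/-! ### Deterministic estimates for the runs of the algorithm -/

namespace RandomRun

variable {n : ℕ} {Ω : Type*} {f : E n → ℝ} {x0 : E n} {P : Params} {A : RandomRun n Ω}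
  {lam1 lamn κ₁ κ₂ β tbar : ℝ}

lemma IsRun.T_mem (hrun : A.IsRun f P x0) (hP : P.Valid) (k : ℕ) (ω : Ω) :
    0 < A.T k ω ∧ A.T k ω ≤ P.tmax := by
  have hτ := hP.τ_pos
  have htmax : 0 < P.tmax := hP.t0_pos.trans_le hP.t0_le_tmax
  induction k with
  | zero => rw [hrun.T_zero]; exact ⟨hP.t0_pos, hP.t0_le_tmax⟩
  | succ k ih =>
    by_cases hs : A.Successful P k ω
    · rw [(hrun.update_success k ω hs).2]
      exact ⟨lt_min htmax (mul_pos (inv_pos.2 hτ) ih.1), min_le_left _ _⟩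
    · rw [(hrun.update_failure k ω hs).2]
      exact ⟨mul_pos hτ ih.1, (mul_le_of_le_one_left ih.1.le hP.τ_lt_one.le).trans ih.2⟩

/-- The true decrease of `f` in a successful iteration. -/
lemma IsRun.decrease (hrun : A.IsRun f P x0) {k : ℕ} {ω : Ω} (hs : A.Successful P k ω) :
    f (A.X (k + 1) ω) ≤ f (A.X k ω) -
      (P.c - 2 * P.θ) * A.T k ω * -inner ℝ (A.G k ω) (A.S k ω) := by
  rw [(hrun.update_success k ω hs).1]
  have h1 := abs_le.1 (hrun.noise_cur k ω)
  have h2 := abs_le.1 (hrun.noise_trial k ω)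
  have h3 : A.ftrial k ω ≤ A.fcur k ω + P.c * A.T k ω * inner ℝ (A.S k ω) (A.G k ω) := hs
  rw [real_inner_comm]
  linarith [h1.1, h2.2]

lemma StepConstants.descent_nonneg (hc : A.StepConstants P lam1 lamn κ₁ κ₂ β) (k : ℕ) (ω : Ω) :
    0 ≤ -inner ℝ (A.G k ω) (A.S k ω) :=
  (mul_nonneg hc.β_pos.le (sq_nonneg _)).trans (hc.descent k ω)

lemma IsRun.f_succ_le (hrun : A.IsRun f P x0) (hP : P.Valid)
    (hc : A.StepConstants P lam1 lamn κ₁ κ₂ β) (k : ℕ) (ω : Ω) :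
    f (A.X (k + 1) ω) ≤ f (A.X k ω) := by
  by_cases hs : A.Successful P k ω
  · have h1 := hrun.decrease hs
    have h2 : 0 ≤ (P.c - 2 * P.θ) * A.T k ω * -inner ℝ (A.G k ω) (A.S k ω) :=
      mul_nonneg (mul_nonneg (by linarith [hP.θ_lt]) (hrun.T_mem hP k ω).1.le)
        (hc.descent_nonneg k ω)
    linarith
  · rw [(hrun.update_failure k ω hs).1]

/-- A true iteration with a sufficiently small step length is successful. -/
lemma IsRun.successful_of_le_threshold (hrun : A.IsRun f P x0) (hP : P.Valid)
    (hf : SmoothStronglyConvex lam1 lamn f) (hlam : 0 ≤ lamn)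
    (hc : A.StepConstants P lam1 lamn κ₁ κ₂ β) {k : ℕ} {ω : Ω} (htrue : ω ∈ A.trueEvent f k)
    (hT : A.T k ω ≤ P.threshold lamn κ₁ β) : A.Successful P k ω := by
  have hκ := hc.κ₁_pos
  have hTpos := (hrun.T_mem hP k ω).1
  have hη := hrun.η_mem k ω
  have hη1 : A.η k ω ≤ 1 := hη.2.le.trans hP.ηbar_lt_one.le
  have hnoise1 := abs_le.1 (hrun.noise_cur k ω)
  have hnoise2 := abs_le.1 (hrun.noise_trial k ω)
  have hquad := hf.le_quadratic (A.X k ω) (A.T k ω • A.S k ω)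
  have hlow := hc.lower k ω
  have hdesc := hc.descent k ω
  have htrue' : ‖A.G k ω - gradient f (A.X k ω)‖ ≤ A.T k ω * A.η k ω * ‖A.G k ω‖ := htrue
  rw [real_inner_comm] at hnoise1 hnoise2
  unfold Successful
  rw [real_inner_comm]
  unfold Params.threshold at hT
  generalize hg : A.G k ω = g at *
  generalize hs : A.S k ω = s at *
  generalize ht : A.T k ω = t at *
  generalize gradient f (A.X k ω) = G at *
  rw [real_inner_smul_right, norm_smul, Real.norm_of_nonneg hTpos.le, mul_pow] at hquad
  -- Accuracy is relative to $t\|g\|$, and $\|g\|\le\|s\|/\kappa_1$, so the gradient error enters at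
  -- second order in $t$, like the curvature term.
  have herr : inner ℝ G s ≤ inner ℝ g s + t * ‖s‖ ^ 2 / κ₁ := by
    have h1 : inner ℝ G s = inner ℝ g s - inner ℝ (g - G) s := by
      rw [inner_sub_left]; ring
    have h2 := neg_le_of_abs_le (abs_real_inner_le_norm (g - G) s)
    have h3 : ‖g - G‖ ≤ t * ‖s‖ / κ₁ := by
      refine htrue'.trans ?_
      rw [le_div_iff₀ hκ]
      have : A.η k ω * (κ₁ * ‖g‖) ≤ 1 * ‖s‖ :=
        mul_le_mul hη1 hlow (by positivity) zero_le_one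
      calc t * A.η k ω * ‖g‖ * κ₁ = t * (A.η k ω * (κ₁ * ‖g‖)) := by ring
        _ ≤ t * (1 * ‖s‖) := mul_le_mul_of_nonneg_left this hTpos.le
        _ = t * ‖s‖ := by ring
    have h4 := mul_le_mul_of_nonneg_right h3 (norm_nonneg s)
    have h5 : t * ‖s‖ / κ₁ * ‖s‖ = t * ‖s‖ ^ 2 / κ₁ := by ring
    linarith
  have hden : 0 < κ₁ * lamn + 2 := by positivity
  -- The parameter conditions do not give this sign; it follows from $0<t\le\hat t$.
  have hfac : 0 ≤ 1 - P.c - 2 * P.θ := by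
    by_contra hneg
    have : 2 * κ₁ * β / (κ₁ * lamn + 2) * (1 - P.c - 2 * P.θ) < 0 :=
      mul_neg_of_pos_of_neg (by have := hc.β_pos; positivity) (not_le.1 hneg)
    linarith
  have hmain : t * (1 / κ₁ + lamn / 2) ≤ β * (1 - P.c - 2 * P.θ) := by
    rw [div_mul_eq_mul_div, le_div_iff₀ hden] at hT
    have : t * (1 / κ₁ + lamn / 2) = t * (κ₁ * lamn + 2) / (2 * κ₁) := by
      field_simp; ring
    rw [this, div_le_iff₀ (by positivity)]
    linarith
  have hA : t * (1 / κ₁ + lamn / 2) * ‖s‖ ^ 2 ≤ (1 - P.c - 2 * P.θ) * -inner ℝ g s :=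
    calc t * (1 / κ₁ + lamn / 2) * ‖s‖ ^ 2 ≤ β * (1 - P.c - 2 * P.θ) * ‖s‖ ^ 2 := by gcongr
      _ = (1 - P.c - 2 * P.θ) * (β * ‖s‖ ^ 2) := by ring
      _ ≤ _ := mul_le_mul_of_nonneg_left hdesc hfac
  have hB := mul_le_mul_of_nonneg_left hA hTpos.le
  have hC := mul_le_mul_of_nonneg_left herr hTpos.le
  have hD : t * (t * (1 / κ₁ + lamn / 2) * ‖s‖ ^ 2) =
      t * (t * ‖s‖ ^ 2 / κ₁) + lamn / 2 * (t ^ 2 * ‖s‖ ^ 2) := by ring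
  linarith [hnoise1.2, hnoise2.1]

/-- The optimality gap contracts in true successful iterations whose step length is not small. -/
lemma IsRun.gap_contraction (hrun : A.IsRun f P x0) (hP : P.Valid)
    (hf : SmoothStronglyConvex lam1 lamn f) (hlam1 : 0 < lam1)
    (hc : A.StepConstants P lam1 lamn κ₁ κ₂ β) {k : ℕ} {ω : Ω} (htrue : ω ∈ A.trueEvent f k)
    (hs : A.Successful P k ω) (htbar : 0 ≤ tbar) (hT : tbar ≤ A.T k ω) (y : E n) :
    f (A.X (k + 1) ω) - f y ≤ (1 - P.M lam1 κ₁ β tbar) * (f (A.X k ω) - f y) := by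
  have hκ := hc.κ₁_pos
  have hβ := hc.β_pos
  obtain ⟨hTpos, hTmax⟩ := hrun.T_mem hP k ω
  have hη := hrun.η_mem k ω
  have hη1 : A.η k ω ≤ 1 := hη.2.le.trans hP.ηbar_lt_one.le
  have hdec := hrun.decrease hs
  have hcθ : 0 < P.c - 2 * P.θ := by linarith [hP.θ_lt]
  have hPL := hf.gap_le_norm_gradient_sq hlam1 (A.X k ω) y
  have htrue' : ‖A.G k ω - gradient f (A.X k ω)‖ ≤ A.T k ω * A.η k ω * ‖A.G k ω‖ := htrue
  -- Source of the factor $(1+t_{\max})^2$ in $M$: accuracy bounds the true gradient by the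
  -- estimate.
  have hgrad : ‖gradient f (A.X k ω)‖ ≤ (1 + P.tmax) * ‖A.G k ω‖ := by
    have h1 : ‖gradient f (A.X k ω)‖ ≤ ‖A.G k ω‖ + ‖A.G k ω - gradient f (A.X k ω)‖ := by
      have := norm_sub_le (A.G k ω) (A.G k ω - gradient f (A.X k ω))
      rwa [sub_sub_cancel] at this
    have h2 : A.T k ω * A.η k ω * ‖A.G k ω‖ ≤ P.tmax * 1 * ‖A.G k ω‖ := by
      have := hη.1
      have := hTpos.le.trans hTmax
      gcongr
    linarith
  have hgap : 2 * lam1 * (f (A.X k ω) - f y) ≤ (1 + P.tmax) ^ 2 * ‖A.G k ω‖ ^ 2 := by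
    rw [← mul_pow]
    exact hPL.trans (pow_le_pow_left₀ (norm_nonneg _) hgrad 2)
  have htm : 0 < 1 + P.tmax := by linarith
  have hdesc : β * (κ₁ ^ 2 * ‖A.G k ω‖ ^ 2) ≤ -inner ℝ (A.G k ω) (A.S k ω) := by
    refine le_trans ?_ (hc.descent k ω)
    rw [← mul_pow]
    have := hc.lower k ω
    gcongr
  have h1 : P.M lam1 κ₁ β tbar * (f (A.X k ω) - f y) ≤
      (P.c - 2 * P.θ) * tbar * (β * (κ₁ ^ 2 * ‖A.G k ω‖ ^ 2)) := by
    have : P.M lam1 κ₁ β tbar * (f (A.X k ω) - f y) =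
        (P.c - 2 * P.θ) * tbar * (β * κ₁ ^ 2) / (1 + P.tmax) ^ 2 *
          (2 * lam1 * (f (A.X k ω) - f y)) := by
      unfold Params.M; ring
    rw [this]
    calc _ ≤ (P.c - 2 * P.θ) * tbar * (β * κ₁ ^ 2) / (1 + P.tmax) ^ 2 *
          ((1 + P.tmax) ^ 2 * ‖A.G k ω‖ ^ 2) := by gcongr
      _ = _ := by field_simp
  have h2 : (P.c - 2 * P.θ) * tbar * (β * (κ₁ ^ 2 * ‖A.G k ω‖ ^ 2)) ≤
      (P.c - 2 * P.θ) * A.T k ω * -inner ℝ (A.G k ω) (A.S k ω) := by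
    gcongr
  linarith

/-! ### The level of the step length -/

/-- The number of reductions by `τ` that take the step length `t_k` to `tbar`, rounded down. -/
noncomputable def level (A : RandomRun n Ω) (P : Params) (tbar : ℝ) (k : ℕ) (ω : Ω) : ℤ :=
  ⌊Real.logb P.τ⁻¹ (A.T k ω / tbar)⌋

lemma level_nonneg_iff (hP : P.Valid) (htbar : 0 < tbar) {k : ℕ} {ω : Ω} (hT : 0 < A.T k ω) :
    0 ≤ A.level P tbar k ω ↔ tbar ≤ A.T k ω := by
  rw [level, Int.floor_nonneg, Real.logb_nonneg_iff (one_lt_inv_iff₀.2 ⟨hP.τ_pos, hP.τ_lt_one⟩)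
    (by positivity), one_le_div htbar]

/-- Rounding down lets a level-0 step length reach almost $\bar t/\tau$, above $\bar t$ itself. The
two alternatives imposed on $\bar t$ deal with this slack. -/
lemma level_nonpos_iff (hP : P.Valid) (htbar : 0 < tbar) {k : ℕ} {ω : Ω} (hT : 0 < A.T k ω) :
    A.level P tbar k ω ≤ 0 ↔ P.τ * A.T k ω < tbar := by
  have h1 : A.level P tbar k ω ≤ 0 ↔ A.level P tbar k ω < 1 := by lia
  rw [h1, level, Int.floor_lt, Int.cast_one,
    Real.logb_lt_iff_lt_rpow (one_lt_inv_iff₀.2 ⟨hP.τ_pos, hP.τ_lt_one⟩) (by positivity),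
    Real.rpow_one, div_lt_iff₀ htbar, lt_inv_mul_iff₀ hP.τ_pos]

lemma IsRun.level_failure (hrun : A.IsRun f P x0) (hP : P.Valid) (htbar : 0 < tbar)
    {k : ℕ} {ω : Ω} (hs : ¬ A.Successful P k ω) :
    A.level P tbar (k + 1) ω = A.level P tbar k ω - 1 := by
  have hT := (hrun.T_mem hP k ω).1
  have hτ := hP.τ_pos
  have h1 := one_lt_inv_iff₀.2 ⟨hP.τ_pos, hP.τ_lt_one⟩
  rw [level, level, ← Int.floor_sub_one, (hrun.update_failure k ω hs).2, mul_div_assoc,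
    Real.logb_mul hτ.ne' (by positivity), Real.logb_inv_base, Real.logb_self_eq_one_iff.2
    ⟨hτ.ne', hP.τ_lt_one.ne, by linarith⟩]
  congr 1; ring

lemma IsRun.level_success (hrun : A.IsRun f P x0) (hP : P.Valid) (htbar : 0 < tbar)
    {k : ℕ} {ω : Ω} (hs : A.Successful P k ω) :
    A.level P tbar (k + 1) ω = min ⌊Real.logb P.τ⁻¹ (P.tmax / tbar)⌋ (A.level P tbar k ω + 1) := by
  have hT := (hrun.T_mem hP k ω).1
  have hτ := hP.τ_pos
  have htmax : 0 < P.tmax := hP.t0_pos.trans_le hP.t0_le_tmax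
  have h1 := one_lt_inv_iff₀.2 ⟨hP.τ_pos, hP.τ_lt_one⟩
  have hadd : A.level P tbar k ω + 1 = ⌊Real.logb P.τ⁻¹ (P.τ⁻¹ * A.T k ω / tbar)⌋ := by
    rw [level, ← Int.floor_add_one, mul_div_assoc, Real.logb_mul (by positivity) (by positivity),
      Real.logb_self_eq_one h1]
    congr 1; ring
  have hmono : ∀ {x y : ℝ}, 0 < x → x ≤ y →
      ⌊Real.logb P.τ⁻¹ (x / tbar)⌋ ≤ ⌊Real.logb P.τ⁻¹ (y / tbar)⌋ := fun hx hxy =>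
    Int.floor_mono (Real.logb_le_logb_of_le h1 (by positivity) (by gcongr))
  rw [hadd, level, (hrun.update_success k ω hs).2]
  rcases le_total P.tmax (P.τ⁻¹ * A.T k ω) with h | h
  · rw [min_eq_left h, min_eq_left (hmono htmax h)]
  · rw [min_eq_right h, min_eq_right (hmono (by positivity) h)]

lemma IsRun.level_le (hrun : A.IsRun f P x0) (hP : P.Valid) (htbar : 0 < tbar) (k : ℕ) (ω : Ω) :
    A.level P tbar k ω ≤ ⌊Real.logb P.τ⁻¹ (P.tmax / tbar)⌋ := by
  have hT := hrun.T_mem hP k ω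
  have := hT.1
  exact Int.floor_mono (Real.logb_le_logb_of_le
    (one_lt_inv_iff₀.2 ⟨hP.τ_pos, hP.τ_lt_one⟩) (by positivity) (by gcongr; exact hT.2))

/-- If the step lengths lie on the grid `τ ^ m * tmax`, they stay there. -/
lemma IsRun.exists_T_eq (hrun : A.IsRun f P x0) (hP : P.Valid) {i : ℕ}
    (hi : P.t0 = P.τ ^ i * P.tmax) (k : ℕ) (ω : Ω) : ∃ m : ℕ, A.T k ω = P.τ ^ m * P.tmax := by
  have hτ := hP.τ_pos
  have htmax : 0 < P.tmax := hP.t0_pos.trans_le hP.t0_le_tmax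
  induction k with
  | zero => exact ⟨i, by rw [hrun.T_zero, hi]⟩
  | succ k ih =>
    obtain ⟨m, hm⟩ := ih
    by_cases hs : A.Successful P k ω
    · rw [(hrun.update_success k ω hs).2, hm]
      cases m with
      | zero =>
        refine ⟨0, min_eq_left ?_ |>.trans (by simp)⟩
        rw [pow_zero, one_mul]
        exact le_mul_of_one_le_left htmax.le (one_lt_inv_iff₀.2 ⟨hτ, hP.τ_lt_one⟩).le
      | succ m =>
        have h1 : P.τ⁻¹ * (P.τ ^ (m + 1) * P.tmax) = P.τ ^ m * P.tmax := by
          field_simp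
          ring
        rw [h1]
        exact ⟨m, min_eq_right (mul_le_of_le_one_left htmax.le
          (pow_le_one₀ hτ.le hP.τ_lt_one.le))⟩
    · rw [(hrun.update_failure k ω hs).2, hm]
      exact ⟨m + 1, by ring⟩

/-- Step lengths of nonpositive level are below the threshold. -/
lemma IsRun.T_le_of_level_nonpos (hrun : A.IsRun f P x0) (hP : P.Valid) {that : ℝ}
    (htbar : 0 < tbar) (hle : tbar ≤ that)
    (hgrid : (∃ i j : ℕ, P.t0 = P.τ ^ i * P.tmax ∧ tbar = P.τ ^ j * P.t0) ∨ tbar ≤ P.τ * that)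
    {k : ℕ} {ω : Ω} (hl : A.level P tbar k ω ≤ 0) : A.T k ω ≤ that := by
  rw [level_nonpos_iff hP htbar (hrun.T_mem hP k ω).1] at hl
  -- On the grid, $\tau t_k<\bar t$ forces $t_k\le\bar t$ by comparing exponents; otherwise the
  -- spare factor $\tau$ in $\bar t\le\tau\hat t$ absorbs the rounding.
  rcases hgrid with ⟨i, j, hi, hj⟩ | h
  · refine le_trans ?_ hle
    have htmax : 0 < P.tmax := hP.t0_pos.trans_le hP.t0_le_tmax
    obtain ⟨m, hm⟩ := hrun.exists_T_eq hP hi k ω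
    rw [hi, ← mul_assoc, ← pow_add] at hj
    rw [hm, hj, ← mul_assoc, ← pow_succ', mul_lt_mul_iff_left₀ htmax,
      pow_lt_pow_iff_right_of_lt_one₀ hP.τ_pos hP.τ_lt_one] at hl
    rw [hm, hj]
    exact mul_le_mul_of_nonneg_right
      (pow_le_pow_of_le_one hP.τ_pos.le hP.τ_lt_one.le (by lia)) htmax.le
  · exact le_of_mul_le_mul_left (hl.le.trans h) hP.τ_pos

/-- The pathwise complexity estimate: the number of iterations is controlled by the initial level,
the number of contractions of the optimality gap and the number of false iterations. -/
lemma IsRun.exists_contractions (hrun : A.IsRun f P x0) (hP : P.Valid)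
    (hf : SmoothStronglyConvex lam1 lamn f) (hlam1 : 0 < lam1) (hlamn : lam1 ≤ lamn)
    (hc : A.StepConstants P lam1 lamn κ₁ κ₂ β) (htbar : 0 < tbar)
    (hle : tbar ≤ P.threshold lamn κ₁ β) (ht0 : tbar ≤ P.τ * P.t0)
    (hgrid : (∃ i j : ℕ, P.t0 = P.τ ^ i * P.tmax ∧ tbar = P.τ ^ j * P.t0) ∨
      tbar ≤ P.τ * P.threshold lamn κ₁ β) (hM : P.M lam1 κ₁ β tbar < 1)
    (y : E n) (ω : Ω) (K : ℕ) :
    ∃ J : ℕ, (K : ℝ) + |A.level P tbar K ω| ≤ A.level P tbar 0 ω + 2 * J +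
        2 * ∑ k ∈ Finset.range K, (A.trueEvent f k)ᶜ.indicator 1 ω ∧
      f (A.X K ω) - f y ≤ (1 - P.M lam1 κ₁ β tbar) ^ J * (f x0 - f y) := by
  -- Ensures that the cap $t_{\max}$ never stops a negative level from rising after a success.
  have hcap : 1 ≤ ⌊Real.logb P.τ⁻¹ (P.tmax / tbar)⌋ := by
    have hτ := hP.τ_pos
    have h1 := one_lt_inv_iff₀.2 ⟨hP.τ_pos, hP.τ_lt_one⟩
    have htmax : 0 < P.tmax := hP.t0_pos.trans_le hP.t0_le_tmax
    rw [Int.le_floor, Int.cast_one, Real.le_logb_iff_rpow_le h1 (by positivity), Real.rpow_one,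
      le_div_iff₀ htbar, inv_mul_le_iff₀ hτ]
    exact ht0.trans (mul_le_mul_of_nonneg_left hP.t0_le_tmax hτ.le)
  induction K with
  | zero =>
    refine ⟨0, ?_, by simp [hrun.X_zero]⟩
    have : 0 ≤ A.level P tbar 0 ω := by
      rw [level_nonneg_iff hP htbar (hrun.T_mem hP 0 ω).1, hrun.T_zero]
      exact ht0.trans (mul_le_of_le_one_left hP.t0_pos.le hP.τ_lt_one.le)
    simp [abs_of_nonneg this]
  | succ K ih =>
    obtain ⟨J, hJ, hgap⟩ := ih
    have hlevel := hrun.level_le hP htbar K ω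
    have hmono : f (A.X (K + 1) ω) - f y ≤ (1 - P.M lam1 κ₁ β tbar) ^ J * (f x0 - f y) :=
      (sub_le_sub_right (hrun.f_succ_le hP hc K ω) _).trans hgap
    rw [Finset.sum_range_succ]
    by_cases htrue : ω ∈ A.trueEvent f K
    · rw [Set.indicator_of_notMem (by simpa using htrue), add_zero]
      by_cases hs : A.Successful P K ω
      · by_cases hl : 0 ≤ A.level P tbar K ω
        · refine ⟨J + 1, ?_, ?_⟩
          · have h1 : |A.level P tbar (K + 1) ω| ≤ |A.level P tbar K ω| + 1 := by
              rw [hrun.level_success hP htbar hs]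
              grind
            have h2 : ((|A.level P tbar (K + 1) ω| : ℤ) : ℝ) ≤ (|A.level P tbar K ω| : ℤ) + 1 := by
              exact_mod_cast h1
            push_cast at hJ h2 ⊢
            linarith
          · have h1 := hrun.gap_contraction hP hf hlam1 hc htrue hs htbar.le
              ((level_nonneg_iff hP htbar (hrun.T_mem hP K ω).1).1 hl) y
            refine h1.trans ?_
            rw [pow_succ', mul_assoc]
            exact mul_le_mul_of_nonneg_left hgap (by linarith)
        · refine ⟨J, ?_, hmono⟩
          have h1 : |A.level P tbar (K + 1) ω| = |A.level P tbar K ω| - 1 := by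
            rw [hrun.level_success hP htbar hs]
            grind
          have h2 : ((|A.level P tbar (K + 1) ω| : ℤ) : ℝ) = (|A.level P tbar K ω| : ℤ) - 1 := by
            exact_mod_cast h1
          push_cast at hJ h2 ⊢
          linarith
      · refine ⟨J, ?_, hmono⟩
        have hl : 0 < A.level P tbar K ω := by
          by_contra hl
          exact hs (hrun.successful_of_le_threshold hP hf (hlam1.le.trans hlamn) hc htrue
            (hrun.T_le_of_level_nonpos hP htbar hle hgrid (not_lt.1 hl)))
        have h1 : |A.level P tbar (K + 1) ω| = |A.level P tbar K ω| - 1 := by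
          rw [hrun.level_failure hP htbar hs]
          grind
        have h2 : ((|A.level P tbar (K + 1) ω| : ℤ) : ℝ) = (|A.level P tbar K ω| : ℤ) - 1 := by
          exact_mod_cast h1
        push_cast at hJ h2 ⊢
        linarith
    · refine ⟨J, ?_, hmono⟩
      rw [Set.indicator_of_mem (by simpa using htrue), Pi.one_apply]
      have h1 : |A.level P tbar (K + 1) ω| ≤ |A.level P tbar K ω| + 1 := by
        by_cases hs : A.Successful P K ω
        · rw [hrun.level_success hP htbar hs]
          grind
        · rw [hrun.level_failure hP htbar hs]
          grind
      have h2 : ((|A.level P tbar (K + 1) ω| : ℤ) : ℝ) ≤ (|A.level P tbar K ω| : ℤ) + 1 := by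
        exact_mod_cast h1
      push_cast at hJ h2 ⊢
      linarith

end RandomRun

namespace RandomRun

/-! ### Measurability with respect to the history -/

section Measurability

variable {n : ℕ} {Ω : Type*} {mΩ : MeasurableSpace Ω} {ℱ : Filtration ℕ mΩ} {f : E n → ℝ}
  {x0 : E n} {P : Params} {A : RandomRun n Ω} {lam1 lamn : ℝ}

lemma IsRun.measurable_X_T (hrun : A.IsRun f P x0) (hA : A.Adapted ℱ) (k : ℕ) :
    Measurable[ℱ k] (A.X k) ∧ Measurable[ℱ k] (A.T k) := by
  classical
  induction k with
  | zero =>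
    rw [show A.X 0 = fun _ => x0 from funext hrun.X_zero,
      show A.T 0 = fun _ => P.t0 from funext hrun.T_zero]
    exact ⟨@measurable_const _ _ _ (ℱ 0) _, @measurable_const _ _ _ (ℱ 0) _⟩
  | succ k ih =>
    have hX := ih.1.mono (ℱ.mono k.le_succ) le_rfl
    have hT := ih.2.mono (ℱ.mono k.le_succ) le_rfl
    have hS := hA.S_meas k
    have hs : MeasurableSet[ℱ (k + 1)] {ω | A.Successful P k ω} :=
      measurableSet_le (hA.ftrial_meas k)
        ((hA.fcur_meas k).add ((hT.const_mul P.c).mul (hS.inner (hA.G_meas k))))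
    have hXeq : A.X (k + 1) = fun ω => if A.Successful P k ω then A.X k ω + A.T k ω • A.S k ω
        else A.X k ω := by
      funext ω
      split_ifs with h
      · exact (hrun.update_success k ω h).1
      · exact (hrun.update_failure k ω h).1
    have hTeq : A.T (k + 1) = fun ω => if A.Successful P k ω then min P.tmax (P.τ⁻¹ * A.T k ω)
        else P.τ * A.T k ω := by
      funext ω
      split_ifs with h
      · exact (hrun.update_success k ω h).2
      · exact (hrun.update_failure k ω h).2
    rw [hXeq, hTeq]
    exact ⟨Measurable.ite hs (hX.add (hT.smul hS)) hX,
      Measurable.ite hs (measurable_const.min (hT.const_mul _)) (hT.const_mul _)⟩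

lemma IsRun.measurableSet_trueEvent (hrun : A.IsRun f P x0) (hA : A.Adapted ℱ)
    (hf : SmoothStronglyConvex lam1 lamn f) (k : ℕ) :
    MeasurableSet[ℱ (k + 1)] (A.trueEvent f k) := by
  have hX := (hrun.measurable_X_T hA k).1.mono (ℱ.mono k.le_succ) le_rfl
  have hT := (hrun.measurable_X_T hA k).2.mono (ℱ.mono k.le_succ) le_rfl
  exact measurableSet_le
    (measurable_norm.comp ((hA.G_meas k).sub (hf.continuous_gradient.measurable.comp hX)))
    ((hT.mul (hA.η_meas k)).mul (measurable_norm.comp (hA.G_meas k)))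

/-- Unlike the true event of iteration $k$, this event is already known to $\mathcal F_k$, so the
conditional accuracy bound can be integrated over it. -/
lemma IsRun.measurableSet_gap (hrun : A.IsRun f P x0) (hA : A.Adapted ℱ)
    (hf : SmoothStronglyConvex lam1 lamn f) (y ε : ℝ) (k : ℕ) :
    MeasurableSet[ℱ k] {ω | ε < f (A.X k ω) - y} :=
  measurableSet_lt measurable_const
    ((hf.1.continuous.measurable.comp (hrun.measurable_X_T hA k).1).sub_const y)

end Measurability

/-! ### Probabilistic estimates -/

section Probability

variable {Ω : Type*} {mΩ : MeasurableSpace Ω} {μ : Measure Ω} [IsProbabilityMeasure μ]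

/-- If `P(s | m) ≥ 1 - δ`, then `P(B ∩ sᶜ) ≤ δ P(B)` for all events `B` of `m`. -/
lemma measureReal_inter_compl_le {m : MeasurableSpace Ω} (hm : m ≤ mΩ) {s B : Set Ω} {δ : ℝ}
    (hs : MeasurableSet[mΩ] s) (hB : MeasurableSet[m] B)
    (h : ∀ᵐ ω ∂μ, 1 - δ ≤ (μ⟦s | m⟧) ω) : μ.real (B ∩ sᶜ) ≤ δ * μ.real B := by
  have hint : Integrable (s.indicator fun _ => (1 : ℝ)) μ :=
    (integrable_const (1 : ℝ)).indicator hs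
  have h1 : ∫ ω in B, (μ⟦s | m⟧) ω ∂μ = μ.real (B ∩ s) := by
    rw [setIntegral_condExp hm hint hB, setIntegral_indicator hs]
    simp
  have h2 : (1 - δ) * μ.real B ≤ ∫ ω in B, (μ⟦s | m⟧) ω ∂μ := by
    have : ∫ _ in B, (1 - δ) ∂μ = (1 - δ) * μ.real B := by
      simp [mul_comm]
    rw [← this]
    exact setIntegral_mono_ae (integrable_const _).integrableOn integrable_condExp.integrableOn h
  have h3 := measureReal_inter_add_sdiff (μ := μ) (s := B) hs
  rw [Set.sdiff_eq] at h3
  linarith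

/-- The first time at which a sequence of events does not occur is at most the number of events
that occur. -/
lemma iInf_notMem_le_tsum (B : ℕ → Set Ω) (ω : Ω) :
    ((⨅ (k : ℕ) (_ : ω ∉ B k), (k : ℕ∞) : ℕ∞) : ℝ≥0∞) ≤ ∑' k, (B k).indicator 1 ω := by
  have key : ∀ m : ℕ, (m : ℕ∞) ≤ (⨅ (k : ℕ) (_ : ω ∉ B k), (k : ℕ∞)) →
      (m : ℝ≥0∞) ≤ ∑' k, (B k).indicator 1 ω := by
    intro m hm
    have hmem : ∀ k < m, ω ∈ B k := by
      intro k hk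
      by_contra hkB
      exact absurd (Nat.cast_le.1 (hm.trans (iInf₂_le k hkB))) (not_le.2 hk)
    calc (m : ℝ≥0∞) = ∑ k ∈ Finset.range m, (B k).indicator 1 ω := by
          rw [Finset.sum_congr rfl fun k hk =>
            Set.indicator_of_mem (hmem k (Finset.mem_range.1 hk)) _]
          simp
      _ ≤ _ := ENNReal.sum_le_tsum _
  generalize (⨅ (k : ℕ) (_ : ω ∉ B k), (k : ℕ∞) : ℕ∞) = N at key
  cases N with
  | top =>
    rw [ENat.toENNReal_top, ← ENNReal.iSup_natCast]
    exact iSup_le fun m => key m le_top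
  | coe m => exact key m le_rfl

/-- Expected number of occurrences of a decreasing sequence of events, given that false iterations
are rare and that a late occurrence is paid for by false iterations. -/
lemma lintegral_iInf_notMem_le {B W : ℕ → Set Ω} {C δ : ℝ} (hC : 0 ≤ C) (hδ : δ < 1 / 2)
    (hB : ∀ k, MeasurableSet (B k)) (hW : ∀ k, MeasurableSet (W k))
    (hanti : ∀ k, B (k + 1) ⊆ B k)
    (hBW : ∀ k, μ.real (B k ∩ W k) ≤ δ * μ.real (B k))
    (hpath : ∀ K, ∀ ω ∈ B K, (K : ℝ) ≤ C + 2 * ∑ k ∈ Finset.range K, (W k).indicator 1 ω) :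
    ∫⁻ ω, ((⨅ (k : ℕ) (_ : ω ∉ B k), (k : ℕ∞) : ℕ∞) : ℝ≥0∞) ∂μ ≤
      ENNReal.ofReal ((1 + C) / (1 - 2 * δ)) := by
  have hsub : ∀ {k m : ℕ}, k ≤ m → B m ⊆ B k := fun h => antitone_nat_of_succ_le hanti h
  -- The extra 1 arises because membership in $B_m$ means $m+1$ occurrences, whereas the path bound
  -- controls $m$. Once outside $B_m$, neither sum grows.
  have hcount : ∀ (m : ℕ) (ω : Ω), ∑ k ∈ Finset.range m, (B k).indicator 1 ω ≤
      (1 + C) + 2 * ∑ k ∈ Finset.range m, (B k ∩ W k).indicator (1 : Ω → ℝ) ω := by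
    intro m ω
    induction m with
    | zero => simp; linarith
    | succ m ih =>
      by_cases hm : ω ∈ B m
      · have h1 : ∑ k ∈ Finset.range (m + 1), (B k).indicator (1 : Ω → ℝ) ω = m + 1 := by
          rw [Finset.sum_congr rfl fun k hk => Set.indicator_of_mem
            (hsub (Nat.lt_succ_iff.1 (Finset.mem_range.1 hk)) hm) _]
          simp
        have h2 : ∑ k ∈ Finset.range m, (B k ∩ W k).indicator (1 : Ω → ℝ) ω =
            ∑ k ∈ Finset.range m, (W k).indicator 1 ω := by
          refine Finset.sum_congr rfl fun k hk => ?_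
          rw [← Set.indicator_indicator,
            Set.indicator_of_mem (hsub (Finset.mem_range.1 hk).le hm)]
        have h3 : 0 ≤ (B m ∩ W m).indicator (1 : Ω → ℝ) ω :=
          Set.indicator_nonneg (fun _ _ => zero_le_one) _
        rw [h1, Finset.sum_range_succ, h2]
        have := hpath m ω hm
        linarith
      · rw [Finset.sum_range_succ, Finset.sum_range_succ, Set.indicator_of_notMem hm,
          Set.indicator_of_notMem (fun h => hm h.1), add_zero, add_zero]
        exact ih
  have hI : ∀ {s : Set Ω}, MeasurableSet s → Integrable (s.indicator (1 : Ω → ℝ)) μ :=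
    fun hs => (integrable_const (1 : ℝ)).indicator hs
  -- Partial sums are finite, so $2\delta S$ can be subtracted before passing to the limit.
  have hpartial : ∀ m : ℕ, ∑ k ∈ Finset.range m, μ.real (B k) ≤ (1 + C) / (1 - 2 * δ) := by
    intro m
    have h1 := integral_mono (μ := μ) (integrable_finsetSum _ fun k _ => hI (hB k))
      ((integrable_const (1 + C)).add
        ((integrable_finsetSum _ fun k _ => hI ((hB k).inter (hW k))).const_mul 2)) (hcount m)
    simp only [Pi.add_apply] at h1
    rw [integral_finsetSum _ fun k _ => hI (hB k), integral_add (integrable_const _)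
        ((integrable_finsetSum _ fun k _ => hI ((hB k).inter (hW k))).const_mul 2),
      integral_const_mul, integral_finsetSum _ fun k _ => hI ((hB k).inter (hW k)),
      Finset.sum_congr rfl fun k _ => integral_indicator_one (hB k),
      Finset.sum_congr rfl fun k _ => integral_indicator_one ((hB k).inter (hW k))] at h1
    simp only [integral_const, probReal_univ, one_smul] at h1
    have h2 : ∑ k ∈ Finset.range m, μ.real (B k ∩ W k) ≤
        δ * ∑ k ∈ Finset.range m, μ.real (B k) := by
      rw [Finset.mul_sum]
      exact Finset.sum_le_sum fun k _ => hBW k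
    rw [le_div_iff₀ (by linarith)]
    linarith
  calc ∫⁻ ω, ((⨅ (k : ℕ) (_ : ω ∉ B k), (k : ℕ∞) : ℕ∞) : ℝ≥0∞) ∂μ
      ≤ ∫⁻ ω, ∑' k, (B k).indicator 1 ω ∂μ := lintegral_mono fun ω => iInf_notMem_le_tsum B ω
    _ = ∑' k, μ (B k) := by
        rw [lintegral_tsum fun k => (measurable_one.indicator (hB k)).aemeasurable]
        exact tsum_congr fun k => lintegral_indicator_one (hB k)
    _ ≤ ENNReal.ofReal ((1 + C) / (1 - 2 * δ)) := by
        rw [ENNReal.tsum_eq_iSup_nat]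
        refine iSup_le fun m => ?_
        rw [← ENNReal.ofReal_toReal (ENNReal.sum_ne_top.2 fun k _ => measure_ne_top μ (B k)),
          ENNReal.toReal_sum fun k _ => measure_ne_top μ (B k)]
        exact ENNReal.ofReal_le_ofReal (hpartial m)

end Probability

/-! ### The range of the contraction factor -/

section Contraction

variable {n : ℕ} {Ω : Type*} {mΩ : MeasurableSpace Ω} {μ : Measure Ω} [IsProbabilityMeasure μ]
  {ℱ : Filtration ℕ mΩ} {f : E n → ℝ} {xstar x0 : E n} {P : Params} {A : RandomRun n Ω}
  {lam1 lamn κ₁ κ₂ β tbar δ ε : ℝ}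

lemma exists_mem_trueEvent (hδ : δ < 1) (hacc : A.GradientAccurate μ ℱ f δ) (k : ℕ) :
    ∃ ω, ω ∈ A.trueEvent f k := by
  by_contra! h
  have h0 : A.trueEvent f k = ∅ := Set.eq_empty_of_forall_notMem h
  have h1 := hacc k
  rw [h0] at h1
  simp only [Set.indicator_empty] at h1
  have h2 : (μ[fun _ : Ω => (0 : ℝ) | ℱ k]) = 0 := condExp_zero
  rw [h2] at h1
  obtain ⟨ω, hω⟩ := h1.exists
  simp only [Pi.zero_apply] at hω
  linarith

/-- Away from the minimizer, accurate gradient estimates force `β κ₁ ≤ 1`. -/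
lemma StepConstants.mul_le_one (hc : A.StepConstants P lam1 lamn κ₁ κ₂ β)
    (hrun : A.IsRun f P x0) (hf : SmoothStronglyConvex lam1 lamn f) (hlam1 : 0 < lam1)
    (hδ : δ < 1) (hacc : A.GradientAccurate μ ℱ f δ) (hgap : 0 < f x0 - f xstar) :
    β * κ₁ ≤ 1 := by
  -- If all gradient estimates vanished, the step inequalities would leave $\beta$ unbounded. A true
  -- realization at the non-optimal $x_0$ provides a nonzero estimate.
  obtain ⟨ω, hω⟩ := exists_mem_trueEvent hδ hacc 0
  have hω' : ‖A.G 0 ω - gradient f (A.X 0 ω)‖ ≤ A.T 0 ω * A.η 0 ω * ‖A.G 0 ω‖ := hω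
  have hG : 0 < ‖A.G 0 ω‖ := by
    rw [norm_pos_iff]
    intro h0
    rw [h0, norm_zero, mul_zero, zero_sub, norm_neg, hrun.X_zero] at hω'
    have h1 := hf.gap_le_norm_gradient_sq hlam1 x0 xstar
    rw [le_antisymm hω' (norm_nonneg _)] at h1
    have : 0 < 2 * lam1 * (f x0 - f xstar) := by positivity
    linarith
  have hκ := hc.κ₁_pos
  have hS : 0 < ‖A.S 0 ω‖ := (mul_pos hκ hG).trans_le (hc.lower 0 ω)
  have h1 := hc.descent 0 ω
  have h2 := neg_le_of_abs_le (abs_real_inner_le_norm (A.G 0 ω) (A.S 0 ω))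
  have h3 : β * ‖A.S 0 ω‖ ≤ ‖A.G 0 ω‖ := le_of_mul_le_mul_right (by nlinarith) hS
  have h4 := mul_le_mul_of_nonneg_left (hc.lower 0 ω) hc.β_pos.le
  exact le_of_mul_le_mul_right (by linarith) hG

lemma StepConstants.M_pos (hc : A.StepConstants P lam1 lamn κ₁ κ₂ β) (hP : P.Valid)
    (hlam1 : 0 < lam1) (htbar : 0 < tbar) : 0 < P.M lam1 κ₁ β tbar := by
  have h1 : 0 < P.c - 2 * P.θ := by linarith [hP.θ_lt]
  have h2 : 0 < 1 + P.tmax := by linarith [hP.t0_pos, hP.t0_le_tmax]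
  have h3 := hc.κ₁_pos
  have h4 := hc.β_pos
  unfold Params.M
  positivity

lemma StepConstants.M_lt_one (hc : A.StepConstants P lam1 lamn κ₁ κ₂ β) (hP : P.Valid)
    (hlam1 : 0 < lam1) (htbar : 0 < tbar) (ht0 : tbar ≤ P.τ * P.t0) (hβκ : β * κ₁ ≤ 1) :
    P.M lam1 κ₁ β tbar < 1 := by
  have htmax : tbar ≤ P.tmax :=
    (ht0.trans (mul_le_of_le_one_left hP.t0_pos.le hP.τ_lt_one.le)).trans hP.t0_le_tmax
  have hκ := hc.κ₁_pos
  have hβ := hc.β_pos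
  have h1 : κ₁ * lam1 ≤ 1 := by
    have := hc.κ₁_le_κ₂.trans hc.κ₂_le
    rwa [le_div_iff₀ hlam1] at this
  have h2 : 0 < P.c - 2 * P.θ := by linarith [hP.θ_lt]
  have h3 : P.c - 2 * P.θ ≤ 1 := by linarith [hP.c_lt_one, hP.θ_pos]
  unfold Params.M
  rw [div_lt_one (by nlinarith)]
  -- One factor $\kappa_1$ is paired with $\beta$ and the other with $\lambda_1$; what remains is
  -- $2t_{\max}<(1+t_{\max})^2$.
  calc 2 * (P.c - 2 * P.θ) * β * κ₁ ^ 2 * lam1 * tbar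
      = 2 * ((P.c - 2 * P.θ) * ((β * κ₁) * (κ₁ * lam1))) * tbar := by ring
    _ ≤ 2 * (1 * (1 * 1)) * P.tmax := by gcongr
    _ < (1 + P.tmax) ^ 2 := by nlinarith

end Contraction

end RandomRun

/-! ### Counting contractions and assembling the expected complexity bound -/

lemma natCast_le_logb {M Δ ε : ℝ} (hM0 : 0 < M) (hM1 : M < 1) (hΔ : 0 < Δ) (hε : 0 < ε) {J : ℕ}
    (h : ε ≤ (1 - M) ^ J * Δ) : (J : ℝ) ≤ Real.logb (1 / (1 - M)) (Δ / ε) := by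
  have h1 : 0 < 1 - M := by linarith
  rw [Real.le_logb_iff_rpow_le ((one_lt_div h1).2 (by linarith)) (by positivity),
    Real.rpow_natCast, one_div, inv_pow, le_div_iff₀ hε, inv_mul_le_iff₀ (by positivity)]
  exact h

end NewtonCG

theorem theorem4p4 {n : ℕ} {Ω : Type*} {mΩ : MeasurableSpace Ω}
    (μ : Measure Ω) [IsProbabilityMeasure μ] (ℱ : Filtration ℕ mΩ)
    (f : NewtonCG.E n → ℝ) (xstar x0 : NewtonCG.E n) (lam1 lamn δg ε : ℝ)
    (P : NewtonCG.Params) (A : NewtonCG.RandomRun n Ω)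
    (hP : P.Valid)
    (hlam1 : 0 < lam1) (hlamn : lam1 ≤ lamn)
    (hf : NewtonCG.SmoothStronglyConvex lam1 lamn f)
    (hxstar : ∀ x, f xstar ≤ f x)
    (hrun : A.IsRun f P x0) (hadapted : A.Adapted ℱ)
    (hH : ∀ k ω, NewtonCG.SpectralBounds lam1 lamn (A.H k ω))
    (hδ0 : 0 < δg) (hδ : δg < 1 / 2)
    (hacc : A.GradientAccurate μ ℱ f δg)
    (hε : 0 < ε) (hε0 : ε ≤ f x0 - f xstar) :
    A.StepConstants P lam1 lamn ((1 - P.ηbar) / lamn) (1 / lam1) lam1 ∧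
    ∀ κ₁ κ₂ β tbar : ℝ,
      A.StepConstants P lam1 lamn κ₁ κ₂ β →
      0 < tbar → tbar ≤ P.threshold lamn κ₁ β → tbar ≤ P.τ * P.t0 →
      ((∃ i j : ℕ, P.t0 = P.τ ^ i * P.tmax ∧ tbar = P.τ ^ j * P.t0) ∨
        tbar ≤ P.τ * P.threshold lamn κ₁ β) →
      0 < P.M lam1 κ₁ β tbar ∧ P.M lam1 κ₁ β tbar < 1 ∧
      ∫⁻ ω, (A.hittingTime f (f xstar) ε ω : ℝ≥0∞) ∂μ ≤
        ENNReal.ofReal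
          (2 * (1 - δg) / (1 - 2 * δg) ^ 2 *
            (2 * Real.logb (1 / (1 - P.M lam1 κ₁ β tbar)) ((f x0 - f xstar) / ε) +
              Real.logb P.τ (tbar / P.t0))) := by
  refine ⟨NewtonCG.RandomRun.stepConstants_of_spectralBounds hP hlam1 hlamn hrun hH,
    fun κ₁ κ₂ β tbar hc htbar hle ht0 hgrid => ?_⟩
  have hgap : 0 < f x0 - f xstar := hε.trans_le hε0
  have hM0 := hc.M_pos hP hlam1 htbar
  have hM1 := hc.M_lt_one hP hlam1 htbar ht0
    (hc.mul_le_one hrun hf hlam1 (by linarith) hacc hgap)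
  refine ⟨hM0, hM1, ?_⟩
  set F := Real.logb (1 / (1 - P.M lam1 κ₁ β tbar)) ((f x0 - f xstar) / ε) with hFdef
  set D := Real.logb P.τ (tbar / P.t0) with hDdef
  have hF : 0 ≤ F := by
    have := NewtonCG.natCast_le_logb (J := 0) hM0 hM1 hgap hε (by simpa using hε0)
    rwa [Nat.cast_zero] at this
  have hD1 : 1 ≤ D := by
    have := hP.t0_pos
    rw [hDdef, Real.le_logb_iff_rpow_le_of_base_lt_one hP.τ_pos hP.τ_lt_one (by positivity),
      Real.rpow_one, div_le_iff₀ this]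
    exact ht0
  have hlevel : ∀ ω, (A.level P tbar 0 ω : ℝ) ≤ D := by
    intro ω
    refine (Int.floor_le _).trans_eq ?_
    rw [hrun.T_zero, Real.logb_inv_base, ← Real.logb_inv, inv_div]
  have hmain := NewtonCG.RandomRun.lintegral_iInf_notMem_le (μ := μ)
    (B := fun k => {ω | ε < f (A.X k ω) - f xstar}) (W := fun k => (A.trueEvent f k)ᶜ)
    (C := 2 * F + D) (δ := δg) (by linarith) hδ
    (fun k => ℱ.le k _ (hrun.measurableSet_gap hadapted hf (f xstar) ε k))
    (fun k => (ℱ.le (k + 1) _ (hrun.measurableSet_trueEvent hadapted hf k)).compl)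
    (fun k ω hω => lt_of_lt_of_le hω (sub_le_sub_right (hrun.f_succ_le hP hc k ω) _))
    (fun k => NewtonCG.RandomRun.measureReal_inter_compl_le (ℱ.le k)
      (ℱ.le (k + 1) _ (hrun.measurableSet_trueEvent hadapted hf k))
      (hrun.measurableSet_gap hadapted hf (f xstar) ε k) (hacc k))
    (fun K ω hω => by
      obtain ⟨J, hJ, hJgap⟩ := hrun.exists_contractions hP hf hlam1 hlamn hc htbar hle ht0 hgrid
        hM1 xstar ω K
      have h1 := NewtonCG.natCast_le_logb hM0 hM1 hgap hε
        ((le_of_lt (show ε < f (A.X K ω) - f xstar from hω)).trans hJgap)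
      have h2 : (0 : ℝ) ≤ (|A.level P tbar K ω| : ℤ) := Int.cast_nonneg (abs_nonneg _)
      linarith [hlevel ω])
  have hhit : ∀ ω, A.hittingTime f (f xstar) ε ω =
      ⨅ (k : ℕ) (_ : ω ∉ {ω | ε < f (A.X k ω) - f xstar}), (k : ℕ∞) := by
    intro ω
    simp only [NewtonCG.RandomRun.hittingTime, Set.mem_ofPred_eq, not_lt]
  simp only [hhit]
  refine hmain.trans (ENNReal.ofReal_le_ofReal ?_)
  have hq : 0 < 1 - 2 * δg := by linarith
  rw [div_mul_eq_mul_div, div_le_div_iff₀ hq (by positivity)]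
  -- Since $\bar t\le\tau t_0$ gives $C=2F+D\ge1$, one has $1+C\le 2C$, and
  -- $1-2\delta_g\le1-\delta_g$.
  have h1 : (1 + (2 * F + D)) * (1 - 2 * δg) ≤ 2 * (1 - δg) * (2 * F + D) := by nlinarith
  calc (1 + (2 * F + D)) * (1 - 2 * δg) ^ 2
      = (1 + (2 * F + D)) * (1 - 2 * δg) * (1 - 2 * δg) := by ring
    _ ≤ _ := mul_le_mul_of_nonneg_right h1 hq.le
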